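/- Let $(M^7,g,\omega^3)$ be a smooth $7$-dimensional Riemannian manifold with a $\mathrm G_2$-structure, i.e. $\omega^3$ is a smooth $3$-form that at every point equals $e_{127}+e_{135}-e_{146}-e_{236}-e_{245}+e_{347}+e_{567}$ in a suitable orthonormal basis $e_1,\dots,e_7$ (where $e_{ijk}=e_i\wedge e_j\wedge e_k$). Let $\nabla^g$ be the Levi-Civita connection and let $\nabla$ be a characteristic connection of $(M^7,g,\omega^3)$ with torsion form $\mathrm T$, i.e. $\mathrm T$ is a smooth $3$-form such that the metric connection $$\nabla_XY=\nabla^g_XY+\tfrac12\,\mathrm T(X,Y,-)$$ preserves the $\mathrm G_2$-structure, $\nabla\omega^3=0$ (if $\omega^3$ is cocalibrated, $d*\omega^3=0$, there is exactly one such $\mathrm T$). Vectors and $1$-forms are identified via $g$. Let $\theta$ be a special $\nabla$-parallel vector field, i.e. a smooth vector field with $\nabla^g\theta=0$ and $\theta\,\lrcorner\,\mathrm T=0$. Then $$\nabla^g_\theta\,\omega^3=0,\qquad d(\theta\,\lrcorner\,\omega^3)=\theta\,\lrcorner\,d\omega^3,\qquad \mathcal L_\theta(\theta\,\lrcorner\,\omega^3)=0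 .$$ Here $\theta\,\lrcorner\,\alpha=\alpha(\theta,\cdot,\dots,\cdot)$, and the exterior derivative is taken with the convention $d\alpha=\sum_i(\nabla^g_{e_i}\alpha)\wedge e_i$ (in local coordinates $d\alpha=\sum_i\partial_i\alpha\wedge dx^i$), which is $(-1)^k$ times the usual exterior derivative $d^{\mathrm{std}}\alpha=\sum_i dx^i\wedge\partial_i\alpha$ on $k$-forms $\alpha$; in terms of the latter, the second identity reads $d^{\mathrm{std}}(\theta\,\lrcorner\,\omega^3)=-\,\theta\,\lrcorner\,d^{\mathrm{std}}\omega^3$. -/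

import Mathlib

open Bundle Set Manifold
open scoped Manifold ContDiff Topology

noncomputable section

/-! ## Differential forms on a manifold modelled on a finite-dimensional real vector space `E` -/

section Forms

variable {E : Type*} [NormedAddCommGroup E] [NormedSpace ℝ E]
  {M : Type*} [TopologicalSpace M] [ChartedSpace E M]

variable (E M) in
/-- Vector fields on `M` (no smoothness is built in). -/
abbrev VField : Type _ := Π x : M, TangentSpace 𝓘(ℝ, E) x

variable (E M) in
/-- Differential `k`-forms on `M` (no smoothness is built in). -/
abbrev DForm (k : ℕ) : Type _ := Π x : M, TangentSpace 𝓘(ℝ, E) x [⋀^Fin k]→L[ℝ] ℝ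

/-- The expression of a `k`-form in the preferred chart around `x₀`, i.e. the pull-back of the form
under the inverse of that chart. -/
def DForm.inChart {k : ℕ} (α : DForm E M k) (x₀ : M) (u : E) : E [⋀^Fin k]→L[ℝ] ℝ :=
  (α ((extChartAt 𝓘(ℝ, E) x₀).symm u)).compContinuousLinearMap
    (mfderiv 𝓘(ℝ, E) 𝓘(ℝ, E) (extChartAt 𝓘(ℝ, E) x₀).symm u)

/-- A form is smooth if all its expressions in charts are smooth. -/
def DForm.IsSmooth {k : ℕ} (α : DForm E M k) : Prop :=
  ∀ x₀ : M, ContDiffOn ℝ ∞ (α.inChart x₀) (extChartAt 𝓘(ℝ, E) x₀).target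

/-- The exterior derivative in the usual normalisation,
`dα = ∑ᵢ dxⁱ ∧ ∂ᵢα` in local coordinates: it is computed in the chart at the point. -/
def DForm.stdExtDeriv {k : ℕ} (α : DForm E M k) : DForm E M (k + 1) := fun x ↦
  (extDeriv (α.inChart x) (extChartAt 𝓘(ℝ, E) x x)).compContinuousLinearMap
    (mfderiv 𝓘(ℝ, E) 𝓘(ℝ, E) (extChartAt 𝓘(ℝ, E) x) x)

/-- The exterior derivative with the differential written on the right,
`dα = ∑ᵢ ∂ᵢα ∧ dxⁱ` in local coordinates, equivalently `dα = ∑ᵢ (∇^g_{eᵢ} α) ∧ eᵢ` in a local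
orthonormal frame. As `∂ᵢα ∧ dxⁱ = (-1)ᵏ dxⁱ ∧ ∂ᵢα` for a `k`-form `α`, this is `(-1)ᵏ` times the
exterior derivative in the usual normalisation. -/
def DForm.d {k : ℕ} (α : DForm E M k) : DForm E M (k + 1) := fun x ↦
  (-1 : ℝ) ^ k • α.stdExtDeriv x

/-- The interior product `v ⌟ f = f(v, ·, …, ·)` of a vector and an alternating map. -/
def contract {V : Type*} [AddCommGroup V] [Module ℝ V] [TopologicalSpace V] {k : ℕ}
    (v : V) (f : V [⋀^Fin (k + 1)]→L[ℝ] ℝ) : V [⋀^Fin k]→L[ℝ] ℝ where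
  toMultilinearMap := (f.toAlternatingMap.curryLeft v).toMultilinearMap
  map_eq_zero_of_eq' := (f.toAlternatingMap.curryLeft v).map_eq_zero_of_eq'
  cont := f.cont.comp (continuous_const.finCons continuous_id)

@[simp]
theorem contract_apply {V : Type*} [AddCommGroup V] [Module ℝ V] [TopologicalSpace V] {k : ℕ}
    (v : V) (f : V [⋀^Fin (k + 1)]→L[ℝ] ℝ) (w : Fin k → V) :
    contract v f w = f (Matrix.vecCons v w) := rfl

/-- The interior product `X ⌟ α` of a vector field and a form. -/
def DForm.interior {k : ℕ} (X : VField E M) (α : DForm E M (k + 1)) : DForm E M k :=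
  fun x ↦ contract (X x) (α x)

/-- The value at `x` of `(L_X α)(Y₁, …, Yₖ) = X(α(Y₁, …, Yₖ)) - ∑ᵢ α(Y₁, …, [X, Yᵢ], …, Yₖ)`. -/
def DForm.lieDeriv {k : ℕ} (X : VField E M) (α : DForm E M k) (Y : Fin k → VField E M) (x : M) :
    ℝ :=
  d% (fun y ↦ α y (fun i ↦ Y i y)) x (X x) -
    ∑ i, α x (Function.update (fun j ↦ Y j x) i (VectorField.mlieBracket 𝓘(ℝ, E) X (Y i) x))

/-- `L_X α = 0`: the Lie derivative vanishes at each point, on all vector fields that are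
differentiable there. -/
def DForm.LieDerivEqZero {k : ℕ} [IsManifold 𝓘(ℝ, E) 1 M] (X : VField E M) (α : DForm E M k) : Prop :=
  ∀ (x : M) (Y : Fin k → VField E M), (∀ i, MDiffAt (T% (Y i)) x) → α.lieDeriv X Y x = 0

/-- The value at `x` of `(∇_X α)(Y₁, …, Yₖ) = X(α(Y₁, …, Yₖ)) - ∑ᵢ α(Y₁, …, ∇_X Yᵢ, …, Yₖ)`. -/
def DForm.covDeriv {k : ℕ} [IsManifold 𝓘(ℝ, E) 1 M]
    (cov : CovariantDerivative 𝓘(ℝ, E) E (TangentSpace 𝓘(ℝ, E) : M → Type _))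
    (X : VField E M) (α : DForm E M k) (Y : Fin k → VField E M) (x : M) : ℝ :=
  d% (fun y ↦ α y (fun i ↦ Y i y)) x (X x) -
    ∑ i, α x (Function.update (fun j ↦ Y j x) i (cov (Y i) x (X x)))

/-- `∇_X α = 0`: the covariant derivative along `X` vanishes at each point, on all vector fields
that are differentiable there. -/
def DForm.CovDerivEqZero {k : ℕ} [IsManifold 𝓘(ℝ, E) 1 M]
    (cov : CovariantDerivative 𝓘(ℝ, E) E (TangentSpace 𝓘(ℝ, E) : M → Type _))
    (X : VField E M) (α : DForm E M k) : Prop :=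
  ∀ (x : M) (Y : Fin k → VField E M), (∀ i, MDiffAt (T% (Y i)) x) → α.covDeriv cov X Y x = 0

end Forms

/-! ## The Levi-Civita connection, through the Koszul formula -/

section LeviCivita

variable {E : Type*} [NormedAddCommGroup E] [NormedSpace ℝ E]
  {M : Type*} [TopologicalSpace M] [ChartedSpace E M]
  [RiemannianBundle (fun x : M ↦ TangentSpace 𝓘(ℝ, E) x)]

/-- The function `x ↦ g(X, Y)(x)`. -/
def metricPairing (X Y : VField E M) : M → ℝ := fun x ↦ inner ℝ (X x) (Y x)

/-- The Koszul expression for `g(∇^g_X Y, Z)` at `x`. -/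
def koszul (Y X Z : VField E M) (x : M) : ℝ :=
  (1 / 2 : ℝ) *
    (d% (metricPairing Y Z) x (X x) + d% (metricPairing Z X) x (Y x)
      - d% (metricPairing X Y) x (Z x)
      + inner ℝ (VectorField.mlieBracket 𝓘(ℝ, E) X Y x) (Z x)
      - inner ℝ (VectorField.mlieBracket 𝓘(ℝ, E) Y Z x) (X x)
      + inner ℝ (VectorField.mlieBracket 𝓘(ℝ, E) Z X x) (Y x))

theorem metricPairing_comm (X Y : VField E M) : metricPairing X Y = metricPairing Y X :=
  funext fun _ ↦ real_inner_comm _ _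

section Sharp

variable [FiniteDimensional ℝ E]

/-- The vector dual to a linear form with respect to the Riemannian metric. -/
def sharp {x : M} (l : TangentSpace 𝓘(ℝ, E) x →L[ℝ] ℝ) : TangentSpace 𝓘(ℝ, E) x :=
  haveI : FiniteDimensional ℝ (TangentSpace 𝓘(ℝ, E) x) := inferInstanceAs (FiniteDimensional ℝ E)
  haveI : CompleteSpace (TangentSpace 𝓘(ℝ, E) x) := FiniteDimensional.complete ℝ _
  (InnerProductSpace.toDual ℝ (TangentSpace 𝓘(ℝ, E) x)).symm l

theorem inner_sharp {x : M} (l : TangentSpace 𝓘(ℝ, E) x →L[ℝ] ℝ) (v : TangentSpace 𝓘(ℝ, E) x) :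
    inner ℝ (sharp l) v = l v := by
  simp [sharp]

/-- The sharp of a bilinear form in its second argument. -/
def sharpHom {x : M} (B : TangentSpace 𝓘(ℝ, E) x →L[ℝ] TangentSpace 𝓘(ℝ, E) x →L[ℝ] ℝ) :
    TangentSpace 𝓘(ℝ, E) x →L[ℝ] TangentSpace 𝓘(ℝ, E) x :=
  haveI : FiniteDimensional ℝ (TangentSpace 𝓘(ℝ, E) x) := inferInstanceAs (FiniteDimensional ℝ E)
  LinearMap.toContinuousLinearMap
    { toFun v := sharp (B v)
      map_add' v w := ext_inner_right ℝ fun u ↦ by simp [inner_sharp, inner_add_left]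
      map_smul' c v := ext_inner_right ℝ fun u ↦ by simp [inner_sharp, real_inner_smul_left] }

theorem inner_sharpHom {x : M}
    (B : TangentSpace 𝓘(ℝ, E) x →L[ℝ] TangentSpace 𝓘(ℝ, E) x →L[ℝ] ℝ)
    (v w : TangentSpace 𝓘(ℝ, E) x) : inner ℝ (sharpHom B v) w = B v w :=
  inner_sharp _ _

end Sharp

variable [IsManifold 𝓘(ℝ, E) 2 M]
  [IsContMDiffRiemannianBundle 𝓘(ℝ, E) 1 E (fun x : M ↦ TangentSpace 𝓘(ℝ, E) x)]

instance instIsContMDiffRiemannianBundleOne {E : Type*} [NormedAddCommGroup E] [NormedSpace ℝ E]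
    {M : Type*} [TopologicalSpace M] [ChartedSpace E M] [IsManifold 𝓘(ℝ, E) 1 M]
    [RiemannianBundle (fun x : M ↦ TangentSpace 𝓘(ℝ, E) x)]
    [h : IsContMDiffRiemannianBundle 𝓘(ℝ, E) ∞ E (fun x : M ↦ TangentSpace 𝓘(ℝ, E) x)] :
    IsContMDiffRiemannianBundle 𝓘(ℝ, E) 1 E (fun x : M ↦ TangentSpace 𝓘(ℝ, E) x) :=
  IsContMDiffRiemannianBundle.of_le (n := ∞) (by norm_cast)

theorem mdifferentiableAt_metricPairing {X Y : VField E M} {x : M} (hX : MDiffAt (T% X) x)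
    (hY : MDiffAt (T% Y) x) : MDiffAt (metricPairing X Y) x :=
  MDifferentiableAt.inner_bundle (IB := 𝓘(ℝ, E)) (F := E)
    (E := fun x : M ↦ TangentSpace 𝓘(ℝ, E) x) (b := id) hX hY

theorem mvfderiv_metricPairing_add_left {X X' Y : VField E M} {x : M} (hX : MDiffAt (T% X) x)
    (hX' : MDiffAt (T% X') x) (hY : MDiffAt (T% Y) x) (v : TangentSpace 𝓘(ℝ, E) x) :
    d% (metricPairing (X + X') Y) x v
      = d% (metricPairing X Y) x v + d% (metricPairing X' Y) x v := by
  have h : metricPairing (X + X') Y = metricPairing X Y + metricPairing X' Y :=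
    funext fun y ↦ inner_add_left _ _ _
  rw [h, mvfderiv_add (mdifferentiableAt_metricPairing hX hY)
    (mdifferentiableAt_metricPairing hX' hY)]
  rfl

theorem mvfderiv_metricPairing_smul_left {f : M → ℝ} {X Y : VField E M} {x : M}
    (hf : MDiffAt f x) (hX : MDiffAt (T% X) x) (hY : MDiffAt (T% Y) x)
    (v : TangentSpace 𝓘(ℝ, E) x) :
    d% (metricPairing (f • X) Y) x v
      = f x * d% (metricPairing X Y) x v + (inner ℝ (X x) (Y x) : ℝ) * d% f x v := by
  have h : metricPairing (f • X) Y = f * metricPairing X Y :=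
    funext fun y ↦ real_inner_smul_left _ _ _
  rw [h, mvfderiv_mul hf (mdifferentiableAt_metricPairing hX hY)]
  rfl

theorem mvfderiv_metricPairing_add_right {X Y Y' : VField E M} {x : M} (hX : MDiffAt (T% X) x)
    (hY : MDiffAt (T% Y) x) (hY' : MDiffAt (T% Y') x) (v : TangentSpace 𝓘(ℝ, E) x) :
    d% (metricPairing X (Y + Y')) x v
      = d% (metricPairing X Y) x v + d% (metricPairing X Y') x v := by
  rw [metricPairing_comm X, metricPairing_comm X, metricPairing_comm X,
    mvfderiv_metricPairing_add_left hY hY' hX]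

theorem mvfderiv_metricPairing_smul_right {f : M → ℝ} {X Y : VField E M} {x : M}
    (hf : MDiffAt f x) (hX : MDiffAt (T% X) x) (hY : MDiffAt (T% Y) x)
    (v : TangentSpace 𝓘(ℝ, E) x) :
    d% (metricPairing X (f • Y)) x v
      = f x * d% (metricPairing X Y) x v + (inner ℝ (X x) (Y x) : ℝ) * d% f x v := by
  rw [metricPairing_comm X, metricPairing_comm X, mvfderiv_metricPairing_smul_left hf hY hX,
    real_inner_comm]

variable [FiniteDimensional ℝ E]

theorem koszul_tensorial_left {x : M} (Y : VField E M) (hY : MDiffAt (T% Y) x) (Z : VField E M)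
    (hZ : MDiffAt (T% Z) x) : TensorialAt 𝓘(ℝ, E) E (fun X : VField E M ↦ koszul Y X Z x) x where
  smul {f X} hf hX := by
    simp only [koszul, mvfderiv_metricPairing_smul_left hf hX hY,
      mvfderiv_metricPairing_smul_right hf hZ hX,
      VectorField.mlieBracket_smul_left hf hX, VectorField.mlieBracket_smul_right hf hX,
      Pi.smul_apply', map_smul, inner_add_left, real_inner_smul_left, real_inner_smul_right,
      smul_eq_mul]
    rw [real_inner_comm (Z x) (X x)]
    ring
  add {X X'} hX hX' := by
    simp only [koszul, mvfderiv_metricPairing_add_left hX hX' hY,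
      mvfderiv_metricPairing_add_right hZ hX hX',
      VectorField.mlieBracket_add_left hX hX', VectorField.mlieBracket_add_right hX hX',
      Pi.add_apply, map_add, inner_add_left, inner_add_right]
    ring

theorem koszul_tensorial_right {x : M} (Y : VField E M) (hY : MDiffAt (T% Y) x) (X : VField E M)
    (hX : MDiffAt (T% X) x) : TensorialAt 𝓘(ℝ, E) E (fun Z : VField E M ↦ koszul Y X Z x) x where
  smul {f Z} hf hZ := by
    simp only [koszul, mvfderiv_metricPairing_smul_left hf hZ hX,
      mvfderiv_metricPairing_smul_right hf hY hZ,
      VectorField.mlieBracket_smul_left hf hZ, VectorField.mlieBracket_smul_right hf hZ,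
      Pi.smul_apply', map_smul, inner_add_left, real_inner_smul_left, real_inner_smul_right,
      smul_eq_mul]
    rw [real_inner_comm (X x) (Z x), real_inner_comm (Y x) (Z x)]
    ring
  add {Z Z'} hZ hZ' := by
    simp only [koszul, mvfderiv_metricPairing_add_left hZ hZ' hX,
      mvfderiv_metricPairing_add_right hY hZ hZ',
      VectorField.mlieBracket_add_left hZ hZ', VectorField.mlieBracket_add_right hZ hZ',
      Pi.add_apply, map_add, inner_add_left, inner_add_right]
    ring

theorem koszul_add {x : M} {Y Y' X Z : VField E M} (hY : MDiffAt (T% Y) x)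
    (hY' : MDiffAt (T% Y') x) (hX : MDiffAt (T% X) x) (hZ : MDiffAt (T% Z) x) :
    koszul (Y + Y') X Z x = koszul Y X Z x + koszul Y' X Z x := by
  simp only [koszul, mvfderiv_metricPairing_add_left hY hY' hZ,
    mvfderiv_metricPairing_add_right hX hY hY',
    VectorField.mlieBracket_add_left hY hY', VectorField.mlieBracket_add_right hY hY',
    Pi.add_apply, map_add, inner_add_left, inner_add_right]
  ring

theorem koszul_leibniz {x : M} {f : M → ℝ} {Y X Z : VField E M} (hf : MDiffAt f x)
    (hY : MDiffAt (T% Y) x) (hX : MDiffAt (T% X) x) (hZ : MDiffAt (T% Z) x) :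
    koszul (f • Y) X Z x = f x * koszul Y X Z x + d% f x (X x) * inner ℝ (Y x) (Z x) := by
  simp only [koszul, mvfderiv_metricPairing_smul_left hf hY hZ,
    mvfderiv_metricPairing_smul_right hf hX hY,
    VectorField.mlieBracket_smul_left hf hY, VectorField.mlieBracket_smul_right hf hY,
    Pi.smul_apply', map_smul, inner_add_left, real_inner_smul_left, real_inner_smul_right,
    smul_eq_mul]
  rw [real_inner_comm (X x) (Y x)]
  ring

open Classical in
/-- `∇^g Y` at `x`, as the linear map `X ↦ ∇^g_X Y` determined by the Koszul formula (and `0` if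
`Y` is not differentiable at `x`). -/
def leviCivitaFun (Y : VField E M) (x : M) :
    TangentSpace 𝓘(ℝ, E) x →L[ℝ] TangentSpace 𝓘(ℝ, E) x :=
  if hY : MDiffAt (T% Y) x then
    sharpHom (TensorialAt.mkHom₂ (fun X Z : VField E M ↦ koszul Y X Z x) x
      (koszul_tensorial_left Y hY) (koszul_tensorial_right Y hY))
  else 0

theorem inner_leviCivitaFun {x : M} {Y X Z : VField E M} (hY : MDiffAt (T% Y) x)
    (hX : MDiffAt (T% X) x) (hZ : MDiffAt (T% Z) x) :
    inner ℝ (leviCivitaFun Y x (X x)) (Z x) = koszul Y X Z x := by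
  rw [leviCivitaFun, dif_pos hY, inner_sharpHom, TensorialAt.mkHom₂_apply _ _ hX hZ]

theorem leviCivitaFun_eq {x : M} {Y : VField E M} (hY : MDiffAt (T% Y) x)
    {A : TangentSpace 𝓘(ℝ, E) x →L[ℝ] TangentSpace 𝓘(ℝ, E) x}
    (h : ∀ X Z : VField E M, MDiffAt (T% X) x → MDiffAt (T% Z) x →
      koszul Y X Z x = inner ℝ (A (X x)) (Z x)) : leviCivitaFun Y x = A := by
  refine ContinuousLinearMap.ext fun v ↦ ext_inner_right ℝ fun w ↦ ?_
  have hv := FiberBundle.mdifferentiableAt_extend 𝓘(ℝ, E) E v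
  have hw := FiberBundle.mdifferentiableAt_extend 𝓘(ℝ, E) E w
  have := (inner_leviCivitaFun hY hv hw).trans (h _ _ hv hw)
  simpa using this

variable (E M) in
/-- The Levi-Civita connection of the Riemannian metric. -/
def leviCivita : CovariantDerivative 𝓘(ℝ, E) E (TangentSpace 𝓘(ℝ, E) : M → Type _) where
  toFun := leviCivitaFun
  isCovariantDerivativeOnUniv :=
    { add := fun {Y Y' x} hY hY' _ ↦ by
        refine leviCivitaFun_eq (mdifferentiableAt_add_section hY hY') fun X Z hX hZ ↦ ?_
        rw [koszul_add hY hY' hX hZ, ← inner_leviCivitaFun hY hX hZ,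
          ← inner_leviCivitaFun hY' hX hZ, ← inner_add_left]
        rfl
      leibniz := fun {Y f x} hY hf _ ↦ by
        refine leviCivitaFun_eq (hf.smul_section hY) fun X Z hX hZ ↦ ?_
        rw [koszul_leibniz hf hY hX hZ, ← inner_leviCivitaFun hY hX hZ,
          ← real_inner_smul_left, ← real_inner_smul_left, ← inner_add_left]
        rfl }

theorem inner_leviCivita {x : M} {Y X Z : VField E M} (hY : MDiffAt (T% Y) x)
    (hX : MDiffAt (T% X) x) (hZ : MDiffAt (T% Z) x) :
    inner ℝ (leviCivita E M Y x (X x)) (Z x) = koszul Y X Z x :=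
  inner_leviCivitaFun hY hX hZ

/-- The Levi-Civita connection is torsion free. -/
theorem leviCivita_torsion {x : M} {X Y : VField E M} (hX : MDiffAt (T% X) x)
    (hY : MDiffAt (T% Y) x) :
    leviCivita E M Y x (X x) - leviCivita E M X x (Y x)
      = VectorField.mlieBracket 𝓘(ℝ, E) X Y x := by
  refine ext_inner_right ℝ fun w ↦ ?_
  have hw := FiberBundle.mdifferentiableAt_extend 𝓘(ℝ, E) E w
  have h1 := inner_leviCivita hY hX hw
  have h2 := inner_leviCivita hX hY hw
  simp only [koszul, FiberBundle.extend_apply_self] at h1 h2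
  rw [metricPairing_comm X (FiberBundle.extend E w), metricPairing_comm (FiberBundle.extend E w) Y,
    metricPairing_comm Y X] at h2
  rw [VectorField.mlieBracket_swap_apply (V := Y) (W := X),
    VectorField.mlieBracket_swap_apply (V := X) (W := FiberBundle.extend E w),
    VectorField.mlieBracket_swap_apply (V := FiberBundle.extend E w) (W := Y)] at h2
  simp only [inner_neg_left] at h2
  rw [inner_sub_left, h1, h2]
  ring

/-- The Levi-Civita connection is compatible with the metric. -/
theorem leviCivita_metric {x : M} {X Y Z : VField E M} (hX : MDiffAt (T% X) x)
    (hY : MDiffAt (T% Y) x) (hZ : MDiffAt (T% Z) x) :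
    d% (metricPairing Y Z) x (X x)
      = inner ℝ (leviCivita E M Y x (X x)) (Z x) + inner ℝ (Y x) (leviCivita E M Z x (X x)) := by
  rw [← real_inner_comm (Y x), inner_leviCivita hY hX hZ, inner_leviCivita hZ hX hY]
  simp only [koszul, metricPairing_comm Z Y, metricPairing_comm Z X, metricPairing_comm Y X]
  rw [VectorField.mlieBracket_swap_apply (V := Z) (W := Y),
    VectorField.mlieBracket_swap_apply (V := X) (W := Z),
    VectorField.mlieBracket_swap_apply (V := Y) (W := X)]
  simp only [inner_neg_left]
  ring

end LeviCivita

/-! ## Connections with skew-symmetric torsion, `G₂`-structures, special parallel fields -/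

section SkewTorsion

variable {E : Type*} [NormedAddCommGroup E] [NormedSpace ℝ E] [FiniteDimensional ℝ E]
  {M : Type*} [TopologicalSpace M] [ChartedSpace E M]
  [RiemannianBundle (fun x : M ↦ TangentSpace 𝓘(ℝ, E) x)]

theorem update_three {V : Type*} (u v w a : V) :
    Function.update ![u, v, w] 0 a = ![a, v, w] ∧ Function.update ![u, v, w] 1 a = ![u, a, w] ∧
      Function.update ![u, v, w] 2 a = ![u, v, a] := by
  refine ⟨?_, ?_, ?_⟩ <;> (ext i; fin_cases i <;> rfl)

theorem alternating_three_add {V : Type*} [AddCommGroup V] [Module ℝ V] [TopologicalSpace V]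
    (f : V [⋀^Fin 3]→L[ℝ] ℝ) (u u' v v' w w' : V) :
    f ![u + u', v, w] = f ![u, v, w] + f ![u', v, w] ∧
    f ![u, v + v', w] = f ![u, v, w] + f ![u, v', w] ∧
    f ![u, v, w + w'] = f ![u, v, w] + f ![u, v, w'] := by
  have h0 := f.map_update_add ![u, v, w] 0 u u'
  have h1 := f.map_update_add ![u, v, w] 1 v v'
  have h2 := f.map_update_add ![u, v, w] 2 w w'
  simp only [(update_three u v w _).1, (update_three u v w _).2.1,
    (update_three u v w _).2.2] at h0 h1 h2
  exact ⟨h0, h1, h2⟩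

theorem alternating_three_smul {V : Type*} [AddCommGroup V] [Module ℝ V] [TopologicalSpace V]
    (f : V [⋀^Fin 3]→L[ℝ] ℝ) (c : ℝ) (u v w : V) :
    f ![c • u, v, w] = c * f ![u, v, w] ∧ f ![u, c • v, w] = c * f ![u, v, w] ∧
    f ![u, v, c • w] = c * f ![u, v, w] := by
  have h0 := f.map_update_smul ![u, v, w] 0 c u
  have h1 := f.map_update_smul ![u, v, w] 1 c v
  have h2 := f.map_update_smul ![u, v, w] 2 c w
  simp only [(update_three u v w _).1, (update_three u v w _).2.1,
    (update_three u v w _).2.2, smul_eq_mul] at h0 h1 h2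
  exact ⟨h0, h1, h2⟩

/-- The linear form `Z ↦ T(X, Y, Z)` on a tangent space. -/
def torsionForm (T : DForm E M 3) {x : M} (X Y : TangentSpace 𝓘(ℝ, E) x) :
    TangentSpace 𝓘(ℝ, E) x →L[ℝ] ℝ :=
  haveI : FiniteDimensional ℝ (TangentSpace 𝓘(ℝ, E) x) := inferInstanceAs (FiniteDimensional ℝ E)
  LinearMap.toContinuousLinearMap
    { toFun Z := T x ![X, Y, Z]
      map_add' Z Z' := (alternating_three_add (T x) X X Y Y Z Z').2.2
      map_smul' c Z := (alternating_three_smul (T x) c X Y Z).2.2 }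

theorem torsionForm_apply (T : DForm E M 3) {x : M} (X Y Z : TangentSpace 𝓘(ℝ, E) x) :
    torsionForm T X Y Z = T x ![X, Y, Z] :=
  rfl

/-- The bilinear map `(Y, X) ↦ T(X, Y, -)♯` on a tangent space: the vector that represents the
linear form `Z ↦ T(X, Y, Z)` with respect to the Riemannian metric. -/
def torsionEnd (T : DForm E M 3) (x : M) :
    TangentSpace 𝓘(ℝ, E) x →L[ℝ] TangentSpace 𝓘(ℝ, E) x →L[ℝ] TangentSpace 𝓘(ℝ, E) x :=
  haveI : FiniteDimensional ℝ (TangentSpace 𝓘(ℝ, E) x) := inferInstanceAs (FiniteDimensional ℝ E)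
  (LinearMap.mk₂ ℝ (fun Y X ↦ sharp (torsionForm T X Y))
    (fun Y Y' X ↦ ext_inner_right ℝ fun Z ↦ by
      simpa only [inner_add_left, inner_sharp, torsionForm_apply] using
        (alternating_three_add (T x) X X Y Y' Z Z).2.1)
    (fun c Y X ↦ ext_inner_right ℝ fun Z ↦ by
      simpa only [real_inner_smul_left, inner_sharp, torsionForm_apply] using
        (alternating_three_smul (T x) c X Y Z).2.1)
    (fun Y X X' ↦ ext_inner_right ℝ fun Z ↦ by
      simpa only [inner_add_left, inner_sharp, torsionForm_apply] using
        (alternating_three_add (T x) X X' Y Y Z Z).1)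
    (fun c Y X ↦ ext_inner_right ℝ fun Z ↦ by
      simpa only [real_inner_smul_left, inner_sharp, torsionForm_apply] using
        (alternating_three_smul (T x) c X Y Z).1)).toContinuousBilinearMap

theorem inner_torsionEnd (T : DForm E M 3) {x : M} (X Y Z : TangentSpace 𝓘(ℝ, E) x) :
    inner ℝ (torsionEnd T x Y X) Z = T x ![X, Y, Z] :=
  inner_sharp _ _

variable [IsManifold 𝓘(ℝ, E) 2 M]
  [IsContMDiffRiemannianBundle 𝓘(ℝ, E) 1 E (fun x : M ↦ TangentSpace 𝓘(ℝ, E) x)]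

/-- The metric connection `∇_X Y = ∇^g_X Y + ½ T(X, Y, -)` with torsion the `3`-form `T`. -/
def torsionConnection (T : DForm E M 3) :
    CovariantDerivative 𝓘(ℝ, E) E (TangentSpace 𝓘(ℝ, E) : M → Type _) :=
  (leviCivita E M).addOneForm fun x ↦ (1 / 2 : ℝ) • torsionEnd T x

theorem torsionConnection_apply (T : DForm E M 3) (Y : VField E M) {x : M}
    (v : TangentSpace 𝓘(ℝ, E) x) :
    torsionConnection T Y x v = leviCivita E M Y x v + (1 / 2 : ℝ) • torsionEnd T x (Y x) v :=
  rfl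

/-- `T` is a characteristic torsion form of the `3`-form `φ`: a smooth `3`-form such that the metric
connection `∇ = ∇^g + ½ T` with skew-symmetric torsion `T` preserves `φ`, i.e. `∇φ = 0`. -/
structure IsCharacteristicTorsion (φ T : DForm E M 3) : Prop where
  smooth : T.IsSmooth
  preserves : ∀ X : VField E M, φ.CovDerivEqZero (torsionConnection T) X

/-- The set `SP^∇` of special `∇`-parallel vector fields, where `∇ = ∇^g + ½ T`: the smooth vector
fields `θ` with `∇^g θ = 0` and `θ ⌟ T = 0`. -/
def specialParallel (T : DForm E M 3) : Set (VField E M) :=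
  {θ | CMDiff ∞ (T% θ) ∧ (∀ x, leviCivita E M θ x = 0) ∧ T.interior θ = 0}

end SkewTorsion

section G2

/-- The `3`-form `e_i ∧ e_j ∧ e_k` of an orthonormal basis, evaluated on three vectors. -/
def wedge₃ {V : Type*} [NormedAddCommGroup V] [InnerProductSpace ℝ V]
    (e : OrthonormalBasis (Fin 7) ℝ V) (i j k : Fin 7) (v : Fin 3 → V) : ℝ :=
  Matrix.det (Matrix.of fun p q : Fin 3 ↦ (inner ℝ (e (![i, j, k] p)) (v q) : ℝ))

/-- A `G₂`-structure on a `7`-dimensional Riemannian manifold: a smooth `3`-form that in a suitable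
orthonormal basis `e₁, …, e₇` of each tangent space is
`e₁₂₇ + e₁₃₅ - e₁₄₆ - e₂₃₆ - e₂₄₅ + e₃₄₇ + e₅₆₇` (indices in the code are shifted by one). -/
structure IsG2Structure {M : Type*} [TopologicalSpace M]
    [ChartedSpace (EuclideanSpace ℝ (Fin 7)) M] [IsManifold (𝓡 7) ∞ M]
    [RiemannianBundle (fun x : M ↦ TangentSpace (𝓡 7) x)]
    (φ : DForm (EuclideanSpace ℝ (Fin 7)) M 3) : Prop where
  smooth : φ.IsSmooth
  model : ∀ x : M, ∃ e : OrthonormalBasis (Fin 7) ℝ (TangentSpace (𝓡 7) x),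
    ∀ v : Fin 3 → TangentSpace (𝓡 7) x,
      φ x v = wedge₃ e 0 1 6 v + wedge₃ e 0 2 4 v - wedge₃ e 0 3 5 v - wedge₃ e 1 2 5 v
        - wedge₃ e 1 3 4 v + wedge₃ e 2 3 6 v + wedge₃ e 4 5 6 v

end G2

end

/-!
Let `θ` be a special `∇`-parallel field, where `∇ = ∇^g + ½ T`. As `θ ⌟ T = 0`, the connections `∇`
and `∇^g` agree in the direction of `θ` (`covDeriv_torsionConnection`), so `∇φ = 0` gives
`∇^g_θ φ = 0`. As `∇^g` is torsion free and `∇^g θ = 0`, one has `[θ, Y] = ∇^g_θ Y` for all `Y`, so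
the Lie derivative along `θ` is the covariant derivative along `θ` and `L_θ φ = 0`
(`lieDerivEqZero_of_parallel`). The other two identities only use `L_θ φ = 0`:

* `[θ, θ] = 0` yields `L_θ (θ ⌟ φ) = θ ⌟ L_θ φ = 0` (`lieDerivEqZero_interior`);
* Cartan's formula yields `d(θ ⌟ φ) = -θ ⌟ dφ` for the usual differential, and the sign disappears
  in the normalisation with the differential on the right (`d_interior_of_lieDerivEqZero`).

Cartan's formula is proved at each point in the chart there. The formula in a vector space
(`extDeriv_contract_add_contract_extDeriv`) expresses `d(X ⌟ η) + X ⌟ dη` through the derivatives of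
`η` and of `X`, and this expression is `L_X η` evaluated on coordinate fields
(`lieDeriv_coordField`).
-/

/-! ### Cartan's formula in a vector space -/

section VectorSpace

variable {V : Type*} [NormedAddCommGroup V] [NormedSpace ℝ V] {k : ℕ}

theorem DifferentiableAt.contract {X : V → V} {η : V → V [⋀^Fin (k + 1)]→L[ℝ] ℝ} {u : V}
    (hX : DifferentiableAt ℝ X u) (hη : DifferentiableAt ℝ η u) :
    DifferentiableAt ℝ (fun y ↦ contract (X y) (η y)) u := by
  have hc := (ContinuousAlternatingMap.curryLeftLI (𝕜 := ℝ) (E := V) (F := ℝ)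
    (n := k)).toContinuousLinearMap.differentiable (F := V →L[ℝ] V [⋀^Fin k]→L[ℝ] ℝ)
  have h : DifferentiableAt ℝ (fun y ↦ (η y).curryLeft) u := by
    exact DifferentiableAt.comp (F := V [⋀^Fin (k + 1)]→L[ℝ] ℝ)
      (G := V →L[ℝ] V [⋀^Fin k]→L[ℝ] ℝ) u (hc (η u)) hη
  exact h.clm_apply hX

theorem fderiv_contract_apply {X : V → V} {η : V → V [⋀^Fin (k + 1)]→L[ℝ] ℝ} {u : V}
    (hX : DifferentiableAt ℝ X u) (hη : DifferentiableAt ℝ η u) (v : V) :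
    fderiv ℝ (fun y ↦ contract (X y) (η y)) u v
      = contract (fderiv ℝ X u v) (η u) + contract (X u) (fderiv ℝ η u v) := by
  ext w
  rw [← fderiv_continuousAlternatingMap_apply_const_apply (hX.contract hη)]
  have hg (i : Fin (k + 1)) : DifferentiableAt ℝ
      (fun y ↦ (Matrix.vecCons (X y) w : Fin (k + 1) → V) i) u := by
    refine Fin.cases ?_ (fun j ↦ ?_) i
    · exact hX
    · exact differentiableAt_const _
  simp only [contract_apply]
  rw [fderiv_continuousAlternatingMap_apply_apply
    (g := fun i y ↦ (Matrix.vecCons (X y) w : Fin (k + 1) → V) i) hη hg v, Fin.sum_univ_succ]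
  have h0 (i : Fin k) : η u (Function.update (Matrix.vecCons (X u) w) i.succ
      (fderiv ℝ (fun _ : V ↦ w i) u v)) = 0 :=
    (η u).map_coord_zero i.succ (by simp)
  have h1 : Function.update (Matrix.vecCons (X u) w) 0 (fderiv ℝ X u v)
      = Matrix.vecCons (fderiv ℝ X u v) w := Fin.update_cons_zero _ _ _
  simp only [Matrix.cons_val_succ, Matrix.cons_val_zero, h0, Finset.sum_const_zero, add_zero, h1,
    ContinuousAlternatingMap.add_apply, contract_apply]
  exact add_comm _ _

/-- Cartan's formula `d(X ⌟ η) + X ⌟ dη = L_X η` in a vector space, with the Lie derivative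
evaluated on constant vector fields `w i`, for which `[X, w i] = -D_{w i} X`. In the sum over the
`k + 2` entries of `dη(X, w)`, the first one is `(D_X η)(w)`; the others cancel the part of
`d(X ⌟ η)` in which `η` is differentiated. -/
theorem extDeriv_contract_add_contract_extDeriv {X : V → V} {η : V → V [⋀^Fin (k + 1)]→L[ℝ] ℝ}
    {u : V} (hX : DifferentiableAt ℝ X u) (hη : DifferentiableAt ℝ η u) (w : Fin (k + 1) → V) :
    extDeriv (fun y ↦ contract (X y) (η y)) u w + contract (X u) (extDeriv η u) w
      = fderiv ℝ (fun y ↦ η y w) u (X u)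
        + ∑ i, η u (Function.update w i (fderiv ℝ X u (w i))) := by
  rw [fderiv_continuousAlternatingMap_apply_const_apply hη, contract_apply,
    extDeriv, extDeriv, ContinuousAlternatingMap.alternatizeUncurryFin_apply,
    ContinuousAlternatingMap.alternatizeUncurryFin_apply,
    Fin.sum_univ_succ (n := k + 1)]
  -- Moving the `i`-th entry to the front produces the sign `(-1)ⁱ`.
  have h (i : Fin (k + 1)) : η u (Function.update w i (fderiv ℝ X u (w i)))
      = (-1) ^ (i : ℕ) • η u (Matrix.vecCons (fderiv ℝ X u (w i)) (i.removeNth w)) := by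
    rw [← ContinuousAlternatingMap.map_insertNth, Fin.insertNth_removeNth]
  have h' (i : Fin (k + 1)) : i.succ.removeNth (Matrix.vecCons (X u) w)
      = Matrix.vecCons (X u) (i.removeNth w) := by
    ext j
    refine Fin.cases ?_ (fun j ↦ ?_) j <;> simp [Fin.removeNth]
  simp only [h, h', fderiv_contract_apply hX hη, ContinuousAlternatingMap.add_apply,
    contract_apply, smul_add, Finset.sum_add_distrib, Fin.val_succ, pow_succ, mul_neg, mul_one, neg_smul,
    Finset.sum_neg_distrib, Matrix.cons_val_zero, Matrix.cons_val_succ, Fin.val_zero, pow_zero,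
    one_smul]
  have h0 : Fin.removeNth 0 (Matrix.vecCons (X u) w) = w := rfl
  rw [h0]
  ring

end VectorSpace

/-! ### Vector fields and forms in a chart -/

section Manifold

variable {E : Type*} [NormedAddCommGroup E] [NormedSpace ℝ E]
  {M : Type*} [TopologicalSpace M] [ChartedSpace E M]

/-- The expression of a vector field in the preferred chart around `x₀`, i.e. its pull-back under
the inverse of that chart (with junk value `0` where the derivative of the inverse chart is not
invertible, which on a `C¹` manifold does not happen on the target of the chart). -/
noncomputable def VField.inChart (X : VField E M) (x₀ : M) : E → E :=
  VectorField.mpullback 𝓘(ℝ, E) 𝓘(ℝ, E) (extChartAt 𝓘(ℝ, E) x₀).symm X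

/-- The vector field with constant coefficients `w` in the preferred chart around `x₀`;
it is only meaningful on the source of that chart. -/
noncomputable def coordField (x₀ : M) (w : E) : VField E M :=
  VectorField.mpullback 𝓘(ℝ, E) 𝓘(ℝ, E) (extChartAt 𝓘(ℝ, E) x₀) fun _ ↦ w

section

variable [IsManifold 𝓘(ℝ, E) 1 M]

theorem isInvertible_mfderiv_extChartAt_symm {x₀ : M} {u : E}
    (hu : u ∈ (extChartAt 𝓘(ℝ, E) x₀).target) :
    (mfderiv 𝓘(ℝ, E) 𝓘(ℝ, E) (extChartAt 𝓘(ℝ, E) x₀).symm u).IsInvertible := by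
  have := isInvertible_mfderivWithin_extChartAt_symm hu
  rwa [modelWithCornersSelf_coe, range_id, mfderivWithin_univ] at this

theorem mfderiv_symm_inChart (X : VField E M) {x₀ : M} {u : E}
    (hu : u ∈ (extChartAt 𝓘(ℝ, E) x₀).target) :
    mfderiv 𝓘(ℝ, E) 𝓘(ℝ, E) (extChartAt 𝓘(ℝ, E) x₀).symm u (X.inChart x₀ u)
      = X ((extChartAt 𝓘(ℝ, E) x₀).symm u) :=
  (isInvertible_mfderiv_extChartAt_symm hu).self_apply_inverse _

theorem inChart_coordField {x₀ : M} (w : E) {u : E} (hu : u ∈ (extChartAt 𝓘(ℝ, E) x₀).target) :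
    (coordField (M := M) x₀ w).inChart x₀ u = w := by
  have h : (mfderiv 𝓘(ℝ, E) 𝓘(ℝ, E) (extChartAt 𝓘(ℝ, E) x₀)
      ((extChartAt 𝓘(ℝ, E) x₀).symm u)).comp
        (mfderiv 𝓘(ℝ, E) 𝓘(ℝ, E) (extChartAt 𝓘(ℝ, E) x₀).symm u)
      = ContinuousLinearMap.id ℝ _ := by
    simpa using mfderiv_extChartAt_comp_mfderivWithin_extChartAt_symm hu
  have h1 := isInvertible_mfderiv_extChartAt ((extChartAt 𝓘(ℝ, E) x₀).map_target hu)
  refine (h1.inverse_comp_apply_of_left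
    (f := mfderiv 𝓘(ℝ, E) 𝓘(ℝ, E) (extChartAt 𝓘(ℝ, E) x₀).symm u)).symm.trans ?_
  rw [h]
  exact DFunLike.congr_fun
    (ContinuousLinearMap.inverse_id (R := ℝ) (M := TangentSpace 𝓘(ℝ, E) u)) w

/-- As the derivative of the preferred chart at its base point is the identity, a vector field and
its expression in that chart agree there, as elements of the model space. -/
theorem inChart_self (X : VField E M) (x : M) : X.inChart x (extChartAt 𝓘(ℝ, E) x x) = X x := by
  have h := mfderivWithin_extChartAt_symm_inverse_apply (I := 𝓘(ℝ, E)) (X x)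
  rw [modelWithCornersSelf_coe, range_id, mfderivWithin_univ] at h
  rw [VField.inChart, VectorField.mpullback_apply]
  conv_rhs => rw [← h]
  rw [extChartAt_to_inv]

theorem coordField_self (x : M) (w : E) : coordField (M := M) x w x = w := by
  change (mfderiv 𝓘(ℝ, E) 𝓘(ℝ, E) (extChartAt 𝓘(ℝ, E) x) x).inverse w = w
  rw [mfderiv_extChartAt_self]
  exact DFunLike.congr_fun
    (ContinuousLinearMap.inverse_id (R := ℝ) (M := TangentSpace 𝓘(ℝ, E) x)) w

theorem inChart_apply_inChart {k : ℕ} (α : DForm E M k) (Y : Fin k → VField E M) {x₀ : M} {u : E}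
    (hu : u ∈ (extChartAt 𝓘(ℝ, E) x₀).target) :
    α.inChart x₀ u (fun i ↦ (Y i).inChart x₀ u)
      = α ((extChartAt 𝓘(ℝ, E) x₀).symm u) (fun i ↦ Y i ((extChartAt 𝓘(ℝ, E) x₀).symm u)) :=
  congrArg (α ((extChartAt 𝓘(ℝ, E) x₀).symm u))
    (funext fun i ↦ mfderiv_symm_inChart (Y i) hu)

theorem inChart_interior {k : ℕ} (X : VField E M) (α : DForm E M (k + 1)) {x₀ : M} {u : E}
    (hu : u ∈ (extChartAt 𝓘(ℝ, E) x₀).target) :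
    (α.interior X).inChart x₀ u = contract (X.inChart x₀ u) (α.inChart x₀ u) := by
  ext w
  refine congrArg (α ((extChartAt 𝓘(ℝ, E) x₀).symm u)) (funext fun i ↦ ?_)
  refine Fin.cases ?_ (fun j ↦ ?_) i
  · exact (mfderiv_symm_inChart X hu).symm
  · rfl

end

/-- The chart expression of `L_X α` at the base point, on coordinate fields. The sign of the sum
comes from `[X, w i] = -D_{w i} X`. -/
theorem lieDeriv_coordField [IsManifold 𝓘(ℝ, E) 1 M] {k : ℕ} (α : DForm E M k)
    (X : VField E M) (x : M)
    (hα : DifferentiableAt ℝ (α.inChart x) (extChartAt 𝓘(ℝ, E) x x)) (w : Fin k → E) :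
    α.lieDeriv X (fun i ↦ coordField x (w i)) x
      = fderiv ℝ (fun u ↦ α.inChart x u w) (extChartAt 𝓘(ℝ, E) x x) (X x)
        + ∑ i, α.inChart x (extChartAt 𝓘(ℝ, E) x x) (Function.update w i
            (fderiv ℝ (X.inChart x) (extChartAt 𝓘(ℝ, E) x x) (w i))) := by
  have htarget : (extChartAt 𝓘(ℝ, E) x).target ∈ 𝓝 (extChartAt 𝓘(ℝ, E) x x) :=
    extChartAt_target_mem_nhds x
  -- Near `x` the function `α(Y₁, …, Yₖ)` is `u ↦ α(u)(w)` read in the chart.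
  have hfun : (fun y ↦ α y fun i ↦ coordField x (w i) y)
      =ᶠ[𝓝 x] (fun u ↦ α.inChart x u w) ∘ extChartAt 𝓘(ℝ, E) x := by
    filter_upwards [extChartAt_source_mem_nhds (I := 𝓘(ℝ, E)) x] with y hy
    have hu := (extChartAt 𝓘(ℝ, E) x).map_source hy
    have h := inChart_apply_inChart α (fun i ↦ coordField x (w i)) hu
    simp only [inChart_coordField _ hu] at h
    exact (congrArg (fun z ↦ α z fun i ↦ coordField x (w i) z)
      ((extChartAt 𝓘(ℝ, E) x).left_inv hy)).symm.trans h.symm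
  have hd : d% (fun y ↦ α y fun i ↦ coordField x (w i) y) x (X x)
      = fderiv ℝ (fun u ↦ α.inChart x u w) (extChartAt 𝓘(ℝ, E) x x) (X x) := by
    have h1 : d% (fun y ↦ α y fun i ↦ coordField x (w i) y) x
        = (d% ((fun u ↦ α.inChart x u w) ∘ extChartAt 𝓘(ℝ, E) x) x) :=
      hfun.mfderiv_eq
    have hw := (hα.continuousAlternatingMap_apply_const w).mdifferentiableAt
    rw [h1, mvfderiv_comp_apply x hw (mdifferentiableAt_extChartAt (mem_chart_source E x)),
      mfderiv_extChartAt_self]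
    exact DFunLike.congr_fun mfderiv_eq_fderiv (X x)
  have hbracket (i : Fin k) : VectorField.mlieBracket 𝓘(ℝ, E) X (coordField x (w i)) x
      = -fderiv ℝ (X.inChart x) (extChartAt 𝓘(ℝ, E) x x) (w i) := by
    have hc : (coordField x (w i) : VField E M).inChart x
        =ᶠ[𝓝 (extChartAt 𝓘(ℝ, E) x x)] fun _ ↦ w i :=
      Filter.eventually_of_mem htarget fun u hu ↦ inChart_coordField _ hu
    have h : VectorField.mlieBracket 𝓘(ℝ, E) X (coordField x (w i)) x
        = (mfderiv 𝓘(ℝ, E) 𝓘(ℝ, E) (extChartAt 𝓘(ℝ, E) x) x).inverse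
          (VectorField.lieBracketWithin (E := E) ℝ (X.inChart x)
            ((coordField x (w i) : VField E M).inChart x) univ (extChartAt 𝓘(ℝ, E) x x)) := by
      rw [← VectorField.mlieBracketWithin_univ, VectorField.mlieBracketWithin_apply]
      simp only [modelWithCornersSelf_coe, range_id, VectorField.mpullbackWithin_univ,
        preimage_univ, inter_univ]
      rfl
    have h' : VectorField.lieBracketWithin (E := E) ℝ (X.inChart x)
        ((coordField x (w i) : VField E M).inChart x) univ (extChartAt 𝓘(ℝ, E) x x)
        = -fderiv ℝ (X.inChart x) (extChartAt 𝓘(ℝ, E) x x) (w i) := by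
      rw [VectorField.lieBracketWithin_univ, VectorField.lieBracket, hc.fderiv_eq, hc.eq_of_nhds]
      simp
    rw [h, mfderiv_extChartAt_self]
    exact (DFunLike.congr_fun
      (ContinuousLinearMap.inverse_id (R := ℝ) (M := TangentSpace 𝓘(ℝ, E) x)) _).trans h'
  -- The derivative of the chart at its base point is the identity, so no change of frame occurs.
  have hα0 (v : Fin k → E) : α x v = α.inChart x (extChartAt 𝓘(ℝ, E) x x) v := by
    have h := inChart_apply_inChart α (fun i ↦ coordField x (v i))
      (mem_extChartAt_target (I := 𝓘(ℝ, E)) x)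
    simp only [inChart_coordField _ (mem_extChartAt_target (I := 𝓘(ℝ, E)) x)] at h
    refine Eq.trans ?_ ((congrArg (fun z ↦ α z fun i ↦ coordField x (v i) z)
      (extChartAt_to_inv (I := 𝓘(ℝ, E)) x)).symm.trans h.symm)
    exact congrArg (α x) (funext fun i ↦ (coordField_self x (v i)).symm)
  rw [DForm.lieDeriv, hd, sub_eq_add_neg, ← Finset.sum_neg_distrib]
  congr 1
  refine Finset.sum_congr rfl fun i _ ↦ ?_
  simp only [hbracket, coordField_self]
  rw [← hα0]
  exact neg_eq_iff_eq_neg.2 ((α x).toMultilinearMap.map_update_neg _ i _)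

theorem stdExtDeriv_apply [IsManifold 𝓘(ℝ, E) 1 M] {k : ℕ} (α : DForm E M k) (x : M)
    (w : Fin (k + 1) → E) :
    α.stdExtDeriv x w = extDeriv (α.inChart x) (extChartAt 𝓘(ℝ, E) x x) w := by
  rw [DForm.stdExtDeriv, mfderiv_extChartAt_self]
  rfl

section

variable [CompleteSpace E] [IsManifold 𝓘(ℝ, E) 2 M]

theorem ContMDiffAt.differentiableAt_inChart {X : VField E M} {x : M}
    (hX : CMDiffAt 1 (T% X) x) :
    DifferentiableAt ℝ (X.inChart x) (extChartAt 𝓘(ℝ, E) x x) := by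
  have h := VectorField.contMDiffWithinAt_mpullbackWithin_extChartAt_symm (n := 2) (s := univ)
    (V := X) hX.contMDiffWithinAt uniqueMDiffOn_univ (mem_univ x) (by norm_num)
  rw [preimage_univ, inter_univ, modelWithCornersSelf_coe, range_id,
    VectorField.mpullbackWithin_univ] at h
  have h' := contMDiffAt_vectorSpace_iff_contDiffAt.1
    (h.contMDiffAt (extChartAt_target_mem_nhds x))
  exact h'.differentiableAt (by simp)

theorem mdifferentiableAt_coordField (x : M) (w : E) :
    MDiffAt (T% (coordField x w : VField E M)) x := by
  refine MDifferentiableAt.mpullback_vectorField (n := 2) ?_ contMDiffAt_extChartAt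
    (isInvertible_mfderiv_extChartAt (mem_extChartAt_source x)) le_rfl
  exact (contMDiffAt_vectorSpace_iff_contDiffAt (n := 1)
    (V := fun _ ↦ w)).2 contDiffAt_const |>.mdifferentiableAt (by simp)

end

/-! ### Cartan's formula on a manifold -/

/-- Cartan's formula `d(X ⌟ α) + X ⌟ dα = L_X α` at a point, in the usual normalisation of `d`.
It is enough to have it on coordinate fields, which take arbitrary values at `x`. -/
theorem stdExtDeriv_interior_add_interior_stdExtDeriv [CompleteSpace E] [IsManifold 𝓘(ℝ, E) 2 M]
    {k : ℕ} {α : DForm E M (k + 1)} {X : VField E M} {x : M}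
    (hα : DifferentiableAt ℝ (α.inChart x) (extChartAt 𝓘(ℝ, E) x x))
    (hX : CMDiffAt 1 (T% X) x) (w : Fin (k + 1) → E) :
    (α.interior X).stdExtDeriv x w + α.stdExtDeriv.interior X x w
      = α.lieDeriv X (fun i ↦ coordField x (w i)) x := by
  have h : (α.interior X).inChart x =ᶠ[𝓝 (extChartAt 𝓘(ℝ, E) x x)]
      fun u ↦ contract (X.inChart x u) (α.inChart x u) :=
    Filter.eventually_of_mem (extChartAt_target_mem_nhds x) fun u hu ↦ inChart_interior X α hu
  have h1 : (α.interior X).stdExtDeriv x w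
      = extDeriv (fun u ↦ contract (X.inChart x u) (α.inChart x u)) (extChartAt 𝓘(ℝ, E) x x) w :=
    (stdExtDeriv_apply _ x w).trans (by simp only [extDeriv, h.fderiv_eq])
  have h2 : α.stdExtDeriv.interior X x w
      = contract (V := E) (X x) (extDeriv (α.inChart x) (extChartAt 𝓘(ℝ, E) x x)) w :=
    stdExtDeriv_apply α x (Matrix.vecCons (X x) w)
  have h3 := extDeriv_contract_add_contract_extDeriv hX.differentiableAt_inChart hα w
  rw [inChart_self] at h3
  rw [lieDeriv_coordField α X x hα, h1, h2]
  exact h3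

theorem DForm.IsSmooth.differentiableAt_inChart {k : ℕ} {α : DForm E M k} (hα : α.IsSmooth)
    (x : M) : DifferentiableAt ℝ (α.inChart x) (extChartAt 𝓘(ℝ, E) x x) :=
  ((hα x).contDiffAt (extChartAt_target_mem_nhds x)).differentiableAt (by simp)

/-- With the differential written on the right, contraction with a field that preserves `α`
commutes with `d`: by Cartan's formula the contraction anticommutes with the usual differential, and
the normalising signs of `d` in degrees `k` and `k + 1` differ by `-1`. -/
theorem d_interior_of_lieDerivEqZero [CompleteSpace E] [IsManifold 𝓘(ℝ, E) 2 M]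
    {k : ℕ} {α : DForm E M (k + 1)} {X : VField E M} (hα : α.IsSmooth)
    (hX : CMDiff 1 (T% X)) (h : α.LieDerivEqZero X) : (α.interior X).d = α.d.interior X := by
  funext x
  ext w
  have hc := stdExtDeriv_interior_add_interior_stdExtDeriv (hα.differentiableAt_inChart x) (hX x) w
  rw [h x _ fun i ↦ mdifferentiableAt_coordField (E := E) x (w i)] at hc
  have h1 : (α.interior X).d x w = (-1) ^ k * (α.interior X).stdExtDeriv x w := rfl
  have h2 : α.d.interior X x w = (-1) ^ (k + 1) * α.stdExtDeriv.interior X x w := rfl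
  rw [h1, h2, eq_neg_of_add_eq_zero_left hc, pow_succ]
  ring

/-- Since `[X, X] = 0`, contraction with `X` commutes with `L_X`. -/
theorem lieDerivEqZero_interior [IsManifold 𝓘(ℝ, E) 1 M] {k : ℕ} {α : DForm E M (k + 1)}
    {X : VField E M} (hX : MDiff (T% X)) (hα : α.LieDerivEqZero X) : (α.interior X).LieDerivEqZero X := by
  intro x Y hY
  have h := hα x (Matrix.vecCons X Y) fun i ↦ by
    refine Fin.cases ?_ (fun j ↦ ?_) i
    · exact hX x
    · exact hY j
  have hcons (y : M) : (fun i ↦ (Matrix.vecCons X Y : Fin (k + 1) → VField E M) i y)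
      = Matrix.vecCons (X y) fun i ↦ Y i y := by
    funext i
    refine Fin.cases ?_ (fun j ↦ ?_) i <;> rfl
  have h0 : α x (Function.update (Matrix.vecCons (X x) fun i ↦ Y i x) 0
      (VectorField.mlieBracket 𝓘(ℝ, E) X X x)) = 0 :=
    (α x).map_coord_zero 0 (by simp)
  have hsucc (i : Fin k) (v : TangentSpace 𝓘(ℝ, E) x) :
      Function.update (Matrix.vecCons (X x) fun i ↦ Y i x) i.succ v
        = Matrix.vecCons (X x) (Function.update (fun i ↦ Y i x) i v) :=
    (Fin.cons_update _ _ _ _).symm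
  rw [DForm.lieDeriv, Fin.sum_univ_succ] at h
  simp only [hcons, Matrix.cons_val_zero, Matrix.cons_val_succ, h0, hsucc, zero_add] at h
  exact h

end Manifold

/-! ### Parallel vector fields and connections with skew torsion -/

section Parallel

variable {E : Type*} [NormedAddCommGroup E] [NormedSpace ℝ E] [FiniteDimensional ℝ E]
  {M : Type*} [TopologicalSpace M] [ChartedSpace E M]
  [RiemannianBundle (fun x : M ↦ TangentSpace 𝓘(ℝ, E) x)]

theorem torsionEnd_apply_eq_zero {T : DForm E M 3} {X : VField E M} (h : T.interior X = 0) (x : M)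
    (v : TangentSpace 𝓘(ℝ, E) x) : torsionEnd T x v (X x) = 0 := by
  refine ext_inner_right ℝ fun w ↦ ?_
  rw [inner_torsionEnd, inner_zero_left]
  exact DFunLike.congr_fun (congrFun h x) ![v, w]

variable [IsManifold 𝓘(ℝ, E) 2 M]
  [IsContMDiffRiemannianBundle 𝓘(ℝ, E) 1 E (fun x : M ↦ TangentSpace 𝓘(ℝ, E) x)]

theorem mlieBracket_of_parallel {X Y : VField E M} {x : M} (hX : MDiffAt (T% X) x)
    (hY : MDiffAt (T% Y) x) (h : leviCivita E M X x = 0) :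
    VectorField.mlieBracket 𝓘(ℝ, E) X Y x = leviCivita E M Y x (X x) := by
  rw [← leviCivita_torsion hX hY, h]
  exact sub_zero _

/-- For a parallel field `X` of the Levi-Civita connection `[X, Y] = ∇^g_X Y`, so `L_X = ∇^g_X` on
forms. -/
theorem lieDerivEqZero_of_parallel {k : ℕ} {α : DForm E M k} {X : VField E M}
    (hX : MDiff (T% X)) (h : ∀ x, leviCivita E M X x = 0)
    (hα : α.CovDerivEqZero (leviCivita E M) X) : α.LieDerivEqZero X := by
  intro x Y hY
  rw [← hα x Y hY, DForm.lieDeriv, DForm.covDeriv]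
  simp only [mlieBracket_of_parallel (hX x) (hY _) (h x)]

/-- If `X ⌟ T = 0`, then `∇^g_X` and `∇_X` coincide for the connection `∇ = ∇^g + ½ T`. -/
theorem covDeriv_torsionConnection {k : ℕ} {T : DForm E M 3} {X : VField E M}
    (h : T.interior X = 0) (α : DForm E M k) (Y : Fin k → VField E M) (x : M) :
    α.covDeriv (torsionConnection T) X Y x = α.covDeriv (leviCivita E M) X Y x := by
  simp only [DForm.covDeriv, torsionConnection_apply, torsionEnd_apply_eq_zero h, smul_zero,
    add_zero]

/-- The three identities hold for every smooth form of positive degree that `∇ = ∇^g + ½ T`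
preserves along a special `∇`-parallel field, in any dimension. -/
theorem specialParallel_preserves {k : ℕ} {α : DForm E M (k + 1)} {T : DForm E M 3}
    {X : VField E M} (hα : α.IsSmooth) (hX : X ∈ specialParallel T)
    (h : α.CovDerivEqZero (torsionConnection T) X) :
    α.CovDerivEqZero (leviCivita E M) X ∧ (α.interior X).d = α.d.interior X ∧
      (α.interior X).LieDerivEqZero X := by
  obtain ⟨hsmooth, hpar, hXT⟩ := hX
  have : CompleteSpace E := FiniteDimensional.complete ℝ E
  have hX1 : CMDiff 1 (T% X) := hsmooth.of_le (by simp)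
  have hXd : MDiff (T% X) := hX1.mdifferentiable (by simp)
  have hcov : α.CovDerivEqZero (leviCivita E M) X := fun x Y hY ↦ by
    rw [← covDeriv_torsionConnection hXT, h x Y hY]
  have hlie := lieDerivEqZero_of_parallel hXd hpar hcov
  exact ⟨hcov, d_interior_of_lieDerivEqZero hα hX1 hlie, lieDerivEqZero_interior hXd hlie⟩

end Parallel

theorem mainTheorem9 {M : Type*} [TopologicalSpace M]
    [ChartedSpace (EuclideanSpace ℝ (Fin 7)) M] [IsManifold (𝓡 7) ∞ M]
    [RiemannianBundle (fun x : M ↦ TangentSpace (𝓡 7) x)]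
    [IsContMDiffRiemannianBundle (𝓡 7) ∞ (EuclideanSpace ℝ (Fin 7))
      (fun x : M ↦ TangentSpace (𝓡 7) x)]
    (φ T : DForm (EuclideanSpace ℝ (Fin 7)) M 3)
    (hφ : IsG2Structure φ) (hT : IsCharacteristicTorsion φ T)
    (θ : VField (EuclideanSpace ℝ (Fin 7)) M) (hθ : θ ∈ specialParallel T) :
    φ.CovDerivEqZero (leviCivita (EuclideanSpace ℝ (Fin 7)) M) θ ∧
      (φ.interior θ).d = φ.d.interior θ ∧
      (φ.interior θ).LieDerivEqZero θ := by
  exact specialParallel_preserves hφ.smooth hθ (hT.preserves θ)
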